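/- Let $a,b$ be coprime integers with $a>b\ge 1$. Every positive integer $n$ has a unique representation \[ n=\frac1b\sum_{k=0}^{\ell(n)-1}\varepsilon_k(n)\Big(\frac ab\Big)^k,\qquad \varepsilon_k(n)\in\{0,1,\dots,a-1\},\quad \varepsilon_{\ell(n)-1}(n)\neq 0, \] called its representation in base $a/b$. For a finite sequence of digits $w=(w_{m-1},\dots,w_1,w_0)$, $w_j\in\{0,\dots,a-1\}$, of length $|w|=m$, let \[ S_{k,w}(N)=\#\{1\le n\le N:\ \ell(n)\ge k+|w|,\ (\varepsilon_{k+|w|-1}(n),\dots,\varepsilon_{k+1}(n),\varepsilon_k(n))=w\} \] and let $S_w(N)=\sum_{k=0}^{\ell(N)-|w|}S_{k,w}(N)$ (an empty sum if $\ell(N)<|w|$); this is the total number of occurrences of $w$ in the base $a/b$ representations of $1,\dots,N$. **Theorem.** For all such $a$, $b$ and every such $w$, \[ S_w(N)=\frac{N}{a^{|w|}}\log_{a/b}N+\mathcal O\big(N\log\log N\big)\qquad(N\to\infty), \] where the implied constant may depend on $a$, $b$ and $w$. Consequently $w$ occurs with asymptotic frequency $a^{-|w|}$ among the digits of the representations of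 $1,\dots,N$: \[ \lim_{N\to\infty}\frac{S_w(N)}{\sum_{n=1}^N \ell(n)}=\frac1{a^{|w|}}. \] -/

import Mathlib

open Filter Asymptotics Topology

namespace RationalBase

/-- `IsRepresentation a b n L ε` says that `(ε (L-1), …, ε 1, ε 0)` is a representation of `n` in
base `a / b`: the digits lie in `{0, …, a - 1}`, the leading digit is nonzero, and
`n = (1 / b) * ∑_{k < L} ε k * (a / b) ^ k`. -/
structure IsRepresentation (a b n L : ℕ) (ε : ℕ → ℕ) : Prop where
  digit_lt : ∀ k < L, ε k < a
  length_pos : 0 < L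
  leading_ne_zero : ε (L - 1) ≠ 0
  value : (n : ℚ) = 1 / (b : ℚ) * ∑ k ∈ Finset.range L, (ε k : ℚ) * ((a : ℚ) / b) ^ k

/-- The integer that remains to be represented after `k` digits of `n` have been split off. -/
def remainder (a b n k : ℕ) : ℕ := (fun m => b * m / a)^[k] n

/-- The digit `ε_k(n)` of the base `a / b` representation of `n`. It is `0` for `k ≥ ℓ(n)`. -/
def digit (a b n k : ℕ) : ℕ := b * remainder a b n k % a

/-- The length `ℓ(n)` of the base `a / b` representation of `n`. -/
noncomputable def repLength (a b n : ℕ) : ℕ := sInf {k | remainder a b n k = 0}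

theorem remainder_zero (a b n : ℕ) : remainder a b n 0 = n := rfl

theorem remainder_succ (a b n k : ℕ) :
    remainder a b n (k + 1) = b * remainder a b n k / a := by
  simp only [remainder, Function.iterate_succ_apply']

theorem remainder_succ_left (a b n k : ℕ) :
    remainder a b n (k + 1) = remainder a b (b * n / a) k := rfl

theorem digit_succ_left (a b n k : ℕ) :
    digit a b n (k + 1) = digit a b (b * n / a) k := rfl

theorem remainder_eq_zero_of_le {a b n j k : ℕ} (h : remainder a b n j = 0) (hjk : j ≤ k) :
    remainder a b n k = 0 := by
  induction k, hjk using Nat.le_induction with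
  | base => exact h
  | succ k _ ih => simp [remainder_succ, ih]

theorem exists_remainder_eq_zero {a b : ℕ} (hab : b < a) (n : ℕ) :
    ∃ k, remainder a b n k = 0 := by
  induction n using Nat.strong_induction_on with
  | _ n ih =>
    rcases Nat.eq_zero_or_pos n with rfl | hn
    · exact ⟨0, rfl⟩
    · obtain ⟨k, hk⟩ := ih (b * n / a)
        ((Nat.div_lt_iff_lt_mul (by omega)).2 (by nlinarith))
      exact ⟨k + 1, hk⟩

theorem remainder_repLength {a b : ℕ} (hab : b < a) (n : ℕ) :
    remainder a b n (repLength a b n) = 0 :=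
  Nat.sInf_mem (s := {k | remainder a b n k = 0}) (exists_remainder_eq_zero hab n)

theorem value_eq {a b : ℕ} (hb : 1 ≤ b) (n k : ℕ) :
    (n : ℚ) = 1 / (b : ℚ) * ∑ j ∈ Finset.range k, (digit a b n j : ℚ) * ((a : ℚ) / b) ^ j
      + ((a : ℚ) / b) ^ k * remainder a b n k := by
  have hb0 : (b : ℚ) ≠ 0 := by positivity
  induction k with
  | zero => simp [remainder_zero]
  | succ k ih =>
    have h : (b : ℚ) * remainder a b n k
        = a * remainder a b n (k + 1) + digit a b n k := by
      have := Nat.div_add_mod (b * remainder a b n k) a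
      rw [remainder_succ, digit]
      exact_mod_cast this.symm
    have h' : (remainder a b n k : ℚ)
        = (a * remainder a b n (k + 1) + digit a b n k) / b := by
      field_simp
      linarith
    rw [Finset.sum_range_succ]
    rw [h'] at ih
    refine ih.trans ?_
    rw [pow_succ]
    field_simp
    ring

/-- Every positive integer is represented by the digits `digit a b n k`, `k < repLength a b n`. -/
theorem isRepresentation_digit {a b n : ℕ} (hb : 1 ≤ b) (hab : b < a) (hn : 1 ≤ n) :
    IsRepresentation a b n (repLength a b n) (digit a b n) := by
  have h0 := remainder_repLength hab n
  have hpos : 0 < repLength a b n := by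
    rcases Nat.eq_zero_or_pos (repLength a b n) with h | h
    · rw [h, remainder_zero] at h0
      omega
    · exact h
  refine ⟨fun k _ => Nat.mod_lt _ (by omega), hpos, ?_, ?_⟩
  · obtain ⟨L, hL⟩ : ∃ L, repLength a b n = L + 1 := ⟨repLength a b n - 1, by omega⟩
    have hne : remainder a b n L ≠ 0 := fun h => by
      have : repLength a b n ≤ L := Nat.sInf_le h
      omega
    rw [hL, remainder_succ] at h0
    have hlt : b * remainder a b n L < a := by
      rcases Nat.div_eq_zero_iff.1 h0 with h | h
      · omega
      · exact h
    rw [hL, Nat.add_sub_cancel, digit, Nat.mod_eq_of_lt hlt]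
    exact Nat.mul_ne_zero (by omega) hne
  · have := value_eq (a := a) hb n (repLength a b n)
    rwa [h0, Nat.cast_zero, mul_zero, add_zero] at this

theorem digit_unique_aux {a b : ℕ} (hb : 1 ≤ b) (hab : b < a) (hcop : Nat.Coprime a b) (L : ℕ) :
    ∀ (n : ℕ) (ε : ℕ → ℕ), (∀ k < L, ε k < a) →
      (n : ℚ) = 1 / (b : ℚ) * ∑ k ∈ Finset.range L, (ε k : ℚ) * ((a : ℚ) / b) ^ k →
      remainder a b n L = 0 ∧ ∀ k < L, ε k = digit a b n k := by
  have hb0 : (b : ℚ) ≠ 0 := by positivity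
  have ha0 : (a : ℚ) ≠ 0 := by
    have : 0 < a := by omega
    positivity
  induction L with
  | zero =>
    intro n ε _ hv
    refine ⟨?_, by simp⟩
    simpa [remainder_zero] using hv
  | succ L ih =>
    intro n ε hε hv
    rw [Finset.sum_range_succ'] at hv
    set v : ℚ := 1 / (b : ℚ) * ∑ k ∈ Finset.range L, (ε (k + 1) : ℚ) * ((a : ℚ) / b) ^ k with hvdef
    have hv1 : (b : ℚ) * n = ε 0 + a * v := by
      rw [hv, hvdef]
      have : ∑ k ∈ Finset.range L, (ε (k + 1) : ℚ) * ((a : ℚ) / b) ^ (k + 1)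
          = (a / b) * ∑ k ∈ Finset.range L, (ε (k + 1) : ℚ) * ((a : ℚ) / b) ^ k := by
        rw [Finset.mul_sum]
        exact Finset.sum_congr rfl fun k _ => by ring
      rw [this]
      field_simp
      ring
    obtain ⟨T, hT⟩ : ∃ T : ℕ, (b : ℚ) ^ L * v = T := by
      refine ⟨∑ k ∈ Finset.range L, ε (k + 1) * a ^ k * b ^ (L - 1 - k), ?_⟩
      rw [hvdef]
      push_cast
      rw [Finset.mul_sum, Finset.mul_sum]
      refine Finset.sum_congr rfl fun k hk => ?_
      have hk' : L = (L - 1 - k) + k + 1 := by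
        have := Finset.mem_range.1 hk
        omega
      have hp : (b : ℚ) ^ L = b ^ (L - 1 - k) * b ^ k * b := by
        conv_lhs => rw [hk']
        rw [pow_succ, pow_add]
      rw [hp, div_pow]
      field_simp
    have hnat : b ^ L * (b * n) = b ^ L * ε 0 + a * T := by
      have : (b : ℚ) ^ L * (b * n) = b ^ L * ε 0 + a * T := by
        rw [hv1, ← hT]
        ring
      exact_mod_cast this
    have hmod : b * n ≡ ε 0 [MOD a] := by
      have h1 : b ^ L * (b * n) ≡ b ^ L * ε 0 [MOD a] := by
        rw [hnat]
        simp [Nat.ModEq]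
      exact Nat.ModEq.cancel_left_of_coprime (hcop.pow_right L) h1
    have hd : b * n % a = ε 0 := by
      rw [hmod, Nat.mod_eq_of_lt (hε 0 (by omega))]
    have hv2 : ((b * n / a : ℕ) : ℚ) = v := by
      have h1 : (b : ℚ) * n = a * ((b * n / a : ℕ) : ℚ) + ε 0 := by
        have := Nat.div_add_mod (b * n) a
        rw [hd] at this
        exact_mod_cast this.symm
      apply mul_left_cancel₀ ha0
      linarith
    obtain ⟨h1, h2⟩ := ih (b * n / a) (fun k => ε (k + 1)) (fun k hk => hε (k + 1) (by omega)) hv2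
    refine ⟨h1, fun k hk => ?_⟩
    cases k with
    | zero => exact hd.symm
    | succ k => exact h2 k (by omega)

/-- The representation of an integer in base `a / b` is unique. -/
theorem IsRepresentation.unique {a b n L : ℕ} {ε : ℕ → ℕ} (hb : 1 ≤ b) (hab : b < a)
    (hcop : Nat.Coprime a b) (h : IsRepresentation a b n L ε) :
    L = repLength a b n ∧ ∀ k < L, ε k = digit a b n k := by
  obtain ⟨h1, h2⟩ := digit_unique_aux hb hab hcop L n ε h.digit_lt h.value
  refine ⟨le_antisymm ?_ (Nat.sInf_le h1), h2⟩
  by_contra! hlt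
  have h3 := remainder_eq_zero_of_le (remainder_repLength hab n)
    (show repLength a b n ≤ L - 1 by omega)
  apply h.leading_ne_zero
  rw [h2 (L - 1) (by omega), digit, h3]
  simp

/-- `S_{k,w}(N)`: the number of `1 ≤ n ≤ N` with `ℓ(n) ≥ k + |w|` whose digits at the positions
`k, …, k + |w| - 1` form the pattern `w = (w_{|w|-1}, …, w_1, w_0)`. -/
noncomputable def patternCountAt (a b : ℕ) {m : ℕ} (w : Fin m → Fin a) (k N : ℕ) : ℕ :=
  Set.ncard {n : ℕ | 1 ≤ n ∧ n ≤ N ∧ k + m ≤ repLength a b n ∧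
    ∀ j : Fin m, digit a b n (k + j) = (w j : ℕ)}

/-- `S_w(N) = ∑_{k = 0}^{ℓ(N) - |w|} S_{k,w}(N)`, the sum being empty if `ℓ(N) < |w|`. -/
noncomputable def patternCount (a b : ℕ) {m : ℕ} (w : Fin m → Fin a) (N : ℕ) : ℕ :=
  ∑ k ∈ Finset.range (repLength a b N + 1 - m), patternCountAt a b w k N

end RationalBase

/-!
Splitting off a digit replaces `n` by `⌊b * n / a⌋`, and since `a` and `b` are coprime, the digits
of `n` at the positions `k, …, k + m - 1` form a given pattern exactly when the `k`-th remainder of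
`n` lies in a certain residue class modulo `M = a ^ m` (`exists_residue_of_digits`). The remainder
map is monotone, and its left adjoint `firstWith a b k`, the `k`-th iterate of `x ↦ ⌈a * x / b⌉`,
cuts the integers into blocks on which the `k`-th remainder is constant. With `p = a / b` and
`q = b / a`, the left end of the block of `r` is

  `p ^ k * (r + ∑ j < k, q ^ (j + 1) / b * roundup a b j r)`,

where the `j`-th rounding error is bounded by `b` and periodic in `r` with period `b ^ (j + 1)`.
Hence the total length of the blocks with `r ≡ c` modulo `M` and `r < R` is the expected one, up to
the sums of the jumps of the rounding errors along the residue class. Over a period of length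
`M * b ^ (j + 1)` these jumps cancel, because `M` and `b` are coprime, so the `j`-th sum is at most
`b * min R (M * b ^ (j + 1))` (`abs_sum_jumps_modEq_le`).

For `n` up to `N`, with a representation of length `L`, one has `p ^ k * R ≤ N` and
`p ^ k ≤ p * N * q ^ (L - k)`. Bounding `min 1 X` by `X ^ θ`, for `θ > 0` so small that
`q * b ^ θ < 1`, turns the error at position `k` into a constant times `N * (q ^ θ) ^ (L - k)`
(`exists_abs_patternCountAt_sub_le`). Summing over `k` gives the main term
`N / a ^ m * logb (a / b) N` with an error `O(N)`, which is stronger than the error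
`O(N log log N)`. The sum of the lengths is `N * logb (a / b) N + O(N)`, since all but a
geometrically small share of the integers up to `N` have a nonzero `k`-th remainder
(`exists_abs_sum_repLength_sub_le`), and the limit of the quotient follows.
-/

namespace RationalBase

/-! ### Geometric sums and sums of periodic functions -/

theorem geomSum_le_inv {x : ℝ} (h0 : 0 ≤ x) (h1 : x < 1) (n : ℕ) :
    ∑ i ∈ Finset.range n, x ^ i ≤ (1 - x)⁻¹ :=
  ((summable_geometric_of_lt_one h0 h1).sum_le_tsum _ fun i _ => pow_nonneg h0 i).trans_eq
    (tsum_geometric_of_lt_one h0 h1)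

theorem abs_sum_range_le_mul {f : ℕ → ℝ} {B : ℝ} (hB : ∀ r, |f r| ≤ B) (R : ℕ) :
    |∑ r ∈ Finset.range R, f r| ≤ B * R := by
  refine (Finset.abs_sum_le_sum_abs _ _).trans ((Finset.sum_le_sum fun r _ => hB r).trans_eq ?_)
  simp [mul_comm]

/-- The partial sums of a bounded periodic function whose sum over a period vanishes are bounded
both trivially and by the contribution of a single period. -/
theorem abs_sum_range_le_of_periodic {f : ℕ → ℝ} {B : ℝ} {P : ℕ} (hP : 0 < P)
    (hB : ∀ r, |f r| ≤ B) (hper : ∀ r, f (r + P) = f r)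
    (h0 : ∑ r ∈ Finset.range P, f r = 0) (R : ℕ) :
    |∑ r ∈ Finset.range R, f r| ≤ B * min (R : ℝ) P := by
  have hB0 : 0 ≤ B := (abs_nonneg _).trans (hB 0)
  rw [mul_min_of_nonneg _ _ hB0]
  refine le_min (abs_sum_range_le_mul hB R) ?_
  induction R using Nat.strong_induction_on with
  | _ R ih =>
    rcases le_or_gt P R with h | h
    · obtain ⟨R, rfl⟩ := Nat.exists_eq_add_of_le h
      rw [Finset.sum_range_add, h0, zero_add]
      simp only [add_comm P, hper]
      exact ih R (by omega)
    · refine (abs_sum_range_le_mul hB R).trans ?_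
      gcongr

theorem sum_range_modEq_eq (M c Q : ℕ) (hM : 0 < M) (F : ℕ → ℝ) :
    (∑ r ∈ Finset.range (M * Q), if r ≡ c [MOD M] then F r else 0)
      = ∑ t ∈ Finset.range Q, F (c % M + M * t) := by
  induction Q with
  | zero => simp
  | succ Q ih =>
    rw [Nat.mul_succ, Finset.sum_range_add, ih, Finset.sum_range_succ]
    congr 1
    have h : ∀ r ∈ Finset.range M,
        (if M * Q + r ≡ c [MOD M] then F (M * Q + r) else 0)
          = if r = c % M then F (c % M + M * Q) else 0 := by
      intro r hr
      have hr' := Finset.mem_range.1 hr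
      have : (M * Q + r ≡ c [MOD M]) ↔ r = c % M := by
        simp [Nat.ModEq, Nat.mod_eq_of_lt hr']
      simp only [this]
      split_ifs with h
      · rw [← h, add_comm]
      · rfl
    rw [Finset.sum_congr rfl h]
    simp [Nat.mod_lt _ hM]

/-- An arithmetic progression of length `Q` whose difference is coprime to `Q` runs through all
residue classes modulo `Q`. -/
theorem sum_progression_of_coprime {M Q : ℕ} (hQ : 0 < Q) (hc : Nat.Coprime M Q) {h : ℕ → ℝ}
    (hper : ∀ r, h (r + Q) = h r) (u : ℕ) :
    ∑ t ∈ Finset.range Q, h (u + M * t) = ∑ s ∈ Finset.range Q, h s := by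
  have hmaps : ∀ t ∈ Finset.range Q, (u + M * t) % Q ∈ Finset.range Q := fun t _ =>
    Finset.mem_range.2 (Nat.mod_lt _ hQ)
  have hinj : Set.InjOn (fun t => (u + M * t) % Q) (Finset.range Q : Set ℕ) := by
    intro s hs t ht hst
    have h1 : u + M * s ≡ u + M * t [MOD Q] := hst
    have h2 : s ≡ t [MOD Q] :=
      Nat.ModEq.cancel_left_of_coprime hc.symm (Nat.ModEq.add_left_cancel' u h1)
    exact Nat.ModEq.eq_of_lt_of_lt h2 (by simpa using hs) (by simpa using ht)
  refine Finset.sum_nbij (fun t => (u + M * t) % Q) hmaps hinj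
    (Finset.surjOn_of_injOn_of_card_le _ hmaps hinj le_rfl) fun t _ => ?_
  exact ((show Function.Periodic h Q from hper).map_mod_nat _).symm

/-- The jumps of a `Q`-periodic function along a residue class modulo `M` cancel over a full
period when `M` and `Q` are coprime. -/
theorem abs_sum_jumps_modEq_le {M Q : ℕ} (hM : 0 < M) (hQ : 0 < Q) (hc : Nat.Coprime M Q)
    {h : ℕ → ℝ} (hper : ∀ r, h (r + Q) = h r) {B : ℝ} (hB : ∀ r, h r ∈ Set.Icc 0 B) (c R : ℕ) :
    |∑ r ∈ Finset.range R, if r ≡ c [MOD M] then h (r + 1) - h r else 0|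
      ≤ B * min (R : ℝ) (M * Q : ℕ) := by
  have hmul : ∀ r, h (r + M * Q) = h r := fun r => by
    simpa using (show Function.Periodic h Q from hper).nat_mul M r
  refine abs_sum_range_le_of_periodic (Nat.mul_pos hM hQ) (fun r => ?_) (fun r => ?_) ?_ R
  · split_ifs
    · have h1 := hB r
      have h2 := hB (r + 1)
      rw [abs_le]
      exact ⟨by linarith [h1.2, h2.1], by linarith [h1.1, h2.2]⟩
    · simpa using (hB r).1.trans (hB r).2
  · have h1 : r + M * Q + 1 = r + 1 + M * Q := by ring
    have h2 : (r + M * Q ≡ c [MOD M]) ↔ (r ≡ c [MOD M]) := by simp [Nat.ModEq]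
    simp only [h1, hmul, h2]
  · rw [sum_range_modEq_eq M c Q hM fun r => h (r + 1) - h r, Finset.sum_sub_distrib]
    simp only [add_right_comm _ _ 1]
    rw [sum_progression_of_coprime hQ hc hper, sum_progression_of_coprime hQ hc hper, sub_self]

/-! ### Digit patterns as residue classes -/

/-- The last `m` digits of `n` are prescribed exactly when `n` lies in a certain residue class
modulo `a ^ m`. -/
theorem exists_residue_of_digits {a b : ℕ} (ha : 0 < a) (hab : Nat.Coprime a b) (m : ℕ) :
    ∀ w : ℕ → ℕ, (∀ j < m, w j < a) →
      ∃ c, ∀ n, (∀ j < m, digit a b n j = w j) ↔ n ≡ c [MOD a ^ m] := by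
  induction m with
  | zero => exact fun w _ => ⟨0, fun n => by simp [Nat.modEq_one]⟩
  | succ m ih =>
    intro w hw
    obtain ⟨c', hc'⟩ := ih (fun j => w (j + 1)) fun j hj => hw (j + 1) (by omega)
    have hw0 : w 0 < a := hw 0 (by omega)
    have hcop : Nat.Coprime (a ^ (m + 1)) b := hab.pow_left _
    -- solve `b * c ≡ a * c' + w 0` modulo `a ^ (m + 1)`
    obtain ⟨c, -, hc1 : b * c ≡ a * c' + w 0 [MOD a ^ (m + 1)]⟩ :=
      Nat.exists_mul_mod_eq_of_coprime (a * c' + w 0) hcop.symm (by positivity)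
    refine ⟨c, fun n => ?_⟩
    have key : (b * n % a = w 0 ∧ b * n / a ≡ c' [MOD a ^ m]) ↔
        b * n ≡ a * c' + w 0 [MOD a ^ (m + 1)] := by
      have hdm := Nat.div_add_mod (b * n) a
      constructor
      · rintro ⟨h1, h2⟩
        rw [← hdm, h1, pow_succ']
        exact (Nat.ModEq.mul_left' a h2).add_right _
      · intro h
        have h1 : b * n % a = w 0 := by
          have : b * n ≡ a * c' + w 0 [MOD a] := h.of_dvd (dvd_pow_self a (by omega))
          rw [this]
          simp [Nat.mod_eq_of_lt hw0]
        refine ⟨h1, ?_⟩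
        rw [← hdm, h1, pow_succ'] at h
        exact Nat.ModEq.mul_left_cancel' ha.ne' (Nat.ModEq.add_right_cancel' _ h)
    have hsplit : (∀ j < m + 1, digit a b n j = w j) ↔
        (b * n % a = w 0 ∧ b * n / a ≡ c' [MOD a ^ m]) := by
      rw [← hc']
      constructor
      · intro h
        exact ⟨h 0 (by omega), fun j hj => h (j + 1) (by omega)⟩
      · rintro ⟨h1, h2⟩ j hj
        cases j with
        | zero => exact h1
        | succ j => exact h2 j (by omega)
    rw [hsplit, key]
    constructor
    · intro h
      exact Nat.ModEq.cancel_left_of_coprime hcop (h.trans hc1.symm)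
    · intro h
      exact (h.mul_left b).trans hc1

theorem remainder_add (a b n k j : ℕ) :
    remainder a b n (k + j) = remainder a b (remainder a b n k) j := by
  simp only [remainder, add_comm k j, Function.iterate_add_apply]

theorem digit_add (a b n k j : ℕ) :
    digit a b n (k + j) = digit a b (remainder a b n k) j := by
  simp only [digit, remainder_add]

theorem remainder_eq_zero_iff {a b : ℕ} (hba : b < a) (n k : ℕ) :
    remainder a b n k = 0 ↔ repLength a b n ≤ k :=
  ⟨fun h => Nat.sInf_le h, remainder_eq_zero_of_le (remainder_repLength hba n)⟩

/-! ### The left adjoint of the remainder map -/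

/-- The least `n` whose `k`-th remainder is at least `r`: the `k`-th iterate of
`x ↦ ⌈a * x / b⌉` at `r`. -/
def firstWith (a b k r : ℕ) : ℕ := (fun x => (a * x + (b - 1)) / b)^[k] r

theorem firstWith_succ (a b k r : ℕ) :
    firstWith a b (k + 1) r = (a * firstWith a b k r + (b - 1)) / b := by
  simp only [firstWith, Function.iterate_succ_apply']

theorem firstWith_le_iff {a b : ℕ} (ha : 0 < a) (hb : 1 ≤ b) (k : ℕ) :
    ∀ r n, firstWith a b k r ≤ n ↔ r ≤ remainder a b n k := by
  induction k with
  | zero => exact fun r n => Iff.rfl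
  | succ k ih =>
    intro r n
    rw [firstWith_succ, remainder_succ_left, ← ih, Nat.le_div_iff_mul_le ha, ← Nat.lt_succ_iff,
      Nat.div_lt_iff_lt_mul hb, Nat.succ_mul, mul_comm a, mul_comm n]
    omega

theorem firstWith_mono {a b : ℕ} (ha : 0 < a) (hb : 1 ≤ b) (k : ℕ) :
    Monotone (firstWith a b k) := fun r s h =>
  (firstWith_le_iff ha hb k r _).2 (h.trans ((firstWith_le_iff ha hb k s _).1 le_rfl))

theorem remainder_eq_iff {a b : ℕ} (ha : 0 < a) (hb : 1 ≤ b) (k n r : ℕ) :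
    remainder a b n k = r ↔ firstWith a b k r ≤ n ∧ n < firstWith a b k (r + 1) := by
  rw [firstWith_le_iff ha hb, ← not_le, firstWith_le_iff ha hb]
  omega

theorem firstWith_add_mul {a b : ℕ} (hb : 1 ≤ b) (k : ℕ) :
    ∀ r s, firstWith a b k (r + b ^ k * s) = firstWith a b k r + a ^ k * s := by
  induction k with
  | zero => intro r s; simp [firstWith]
  | succ k ih =>
    intro r s
    rw [firstWith_succ, firstWith_succ, pow_succ, mul_assoc, ih]
    rw [show a * (firstWith a b k r + a ^ k * (b * s)) + (b - 1)
      = a * firstWith a b k r + (b - 1) + b * (a ^ (k + 1) * s) by ring,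
      Nat.add_mul_div_left _ _ hb]

/-- The numerator of the error made by rounding up in the step from `firstWith a b j` to
`firstWith a b (j + 1)`. -/
def roundup (a b j r : ℕ) : ℝ := b * (firstWith a b (j + 1) r : ℝ) - a * firstWith a b j r

theorem roundup_mem_Icc {a b : ℕ} (hb : 1 ≤ b) (j r : ℕ) :
    roundup a b j r ∈ Set.Icc (0 : ℝ) b := by
  have h1 := Nat.div_add_mod (a * firstWith a b j r + (b - 1)) b
  have h2 := Nat.mod_lt (a * firstWith a b j r + (b - 1)) hb
  rw [← firstWith_succ] at h1
  have h3 : a * firstWith a b j r ≤ b * firstWith a b (j + 1) r := by omega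
  have h4 : b * firstWith a b (j + 1) r ≤ a * firstWith a b j r + b := by omega
  have h3' : (a : ℝ) * firstWith a b j r ≤ b * firstWith a b (j + 1) r := by exact_mod_cast h3
  have h4' : (b : ℝ) * firstWith a b (j + 1) r ≤ a * firstWith a b j r + b := by exact_mod_cast h4
  constructor <;> simp only [roundup] <;> linarith

theorem roundup_periodic {a b : ℕ} (hb : 1 ≤ b) (j r : ℕ) :
    roundup a b j (r + b ^ (j + 1)) = roundup a b j r := by
  have h1 := firstWith_add_mul (a := a) hb (j + 1) r 1
  have h2 := firstWith_add_mul (a := a) hb j r b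
  rw [mul_one, mul_one] at h1
  rw [← pow_succ] at h2
  rw [roundup, roundup, h1, h2]
  push_cast
  ring

/-- Closed form of `firstWith` in terms of the rounding errors. -/
theorem firstWith_eq {a b : ℕ} (ha : 0 < a) (hb : 1 ≤ b) (k r : ℕ) :
    (firstWith a b k r : ℝ) = ((a : ℝ) / b) ^ k *
      (r + ∑ j ∈ Finset.range k, ((b : ℝ) / a) ^ (j + 1) / b * roundup a b j r) := by
  have hb0 : (b : ℝ) ≠ 0 := by positivity
  have ha0 : (a : ℝ) ≠ 0 := by positivity
  induction k with
  | zero => simp [firstWith]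
  | succ k ih =>
    have h1 : (firstWith a b (k + 1) r : ℝ)
        = (a : ℝ) / b * firstWith a b k r + 1 / b * roundup a b k r := by
      rw [roundup]
      field_simp
      ring
    have h2 : ((a : ℝ) / b) ^ (k + 1) * ((b : ℝ) / a) ^ (k + 1) = 1 := by
      rw [← mul_pow, div_mul_div_cancel₀ hb0, div_self ha0, one_pow]
    rw [h1, ih, Finset.sum_range_succ, ← add_assoc, mul_add _ _ (_ * roundup a b k r)]
    rw [show ((a : ℝ) / b) ^ (k + 1) * (((b : ℝ) / a) ^ (k + 1) / b * roundup a b k r)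
      = (((a : ℝ) / b) ^ (k + 1) * ((b : ℝ) / a) ^ (k + 1)) * (1 / b * roundup a b k r) by ring,
      h2, one_mul]
    ring

theorem le_firstWith {a b : ℕ} (ha : 0 < a) (hb : 1 ≤ b) (k r : ℕ) :
    ((a : ℝ) / b) ^ k * r ≤ firstWith a b k r := by
  rw [firstWith_eq ha hb]
  gcongr
  refine le_add_of_nonneg_right (Finset.sum_nonneg fun j _ => ?_)
  exact mul_nonneg (by positivity) (roundup_mem_Icc hb j r).1

theorem firstWith_le {a b : ℕ} (hba : b < a) (hb : 1 ≤ b) (k r : ℕ) :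
    (firstWith a b k r : ℝ) ≤ ((a : ℝ) / b) ^ k * (r + (1 - (b : ℝ) / a)⁻¹) := by
  have ha : (0 : ℝ) < a := by exact_mod_cast (by omega : 0 < a)
  have hb0 : (0 : ℝ) < b := by exact_mod_cast hb
  have hq1 : (b : ℝ) / a < 1 := (div_lt_one ha).2 (by exact_mod_cast hba)
  have hq0 : 0 ≤ (b : ℝ) / a := by positivity
  rw [firstWith_eq (by omega) hb]
  gcongr
  refine le_trans (Finset.sum_le_sum fun j _ => ?_) (geomSum_le_inv hq0 hq1 k)
  calc ((b : ℝ) / a) ^ (j + 1) / b * roundup a b j r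
      ≤ ((b : ℝ) / a) ^ (j + 1) / b * b := by
        gcongr
        exact (roundup_mem_Icc hb j r).2
    _ = ((b : ℝ) / a) ^ (j + 1) := by field_simp
    _ ≤ ((b : ℝ) / a) ^ j := pow_le_pow_of_le_one hq0 hq1.le (by omega)

/-! ### Equidistribution of the remainders in residue classes -/

/-- The number of `n < N` whose `k`-th remainder is congruent to `c` modulo `M`. -/
noncomputable def residueCount (a b M c k N : ℕ) : ℝ :=
  ∑ n ∈ Finset.range N, if remainder a b n k ≡ c [MOD M] then 1 else 0

theorem residueCount_sub_mem_Icc (a b M c k : ℕ) {n N : ℕ} (h : n ≤ N) :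
    residueCount a b M c k N - residueCount a b M c k n ∈ Set.Icc (0 : ℝ) (N - n) := by
  rw [residueCount, residueCount, ← Finset.sum_range_add_sum_Ico _ h, add_sub_cancel_left]
  constructor
  · exact Finset.sum_nonneg fun i _ => by split_ifs <;> norm_num
  · rw [← Nat.cast_sub h, ← Nat.card_Ico, ← mul_one (Nat.cast _), ← nsmul_eq_mul]
    exact Finset.sum_le_card_nsmul _ _ _ fun i _ => by split_ifs <;> norm_num

/-- The numbers with `k`-th remainder `r` form the interval from `firstWith a b k r` to
`firstWith a b k (r + 1)`, so a count of remainders is a sum of interval lengths. -/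
theorem residueCount_firstWith {a b : ℕ} (ha : 0 < a) (hb : 1 ≤ b) (M c k R : ℕ) :
    residueCount a b M c k (firstWith a b k R) = ∑ r ∈ Finset.range R,
      if r ≡ c [MOD M] then (firstWith a b k (r + 1) : ℝ) - firstWith a b k r else 0 := by
  induction R with
  | zero =>
    have : firstWith a b k 0 = 0 := Nat.le_zero.1 ((firstWith_le_iff ha hb k 0 0).2 (Nat.zero_le _))
    simp [residueCount, this]
  | succ R ih =>
    have hle := firstWith_mono ha hb k (Nat.le_succ R)
    rw [Finset.sum_range_succ, ← ih, residueCount, residueCount,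
      ← Finset.sum_range_add_sum_Ico _ hle]
    congr 1
    have h : ∀ n ∈ Finset.Ico (firstWith a b k R) (firstWith a b k (R + 1)),
        (if remainder a b n k ≡ c [MOD M] then (1 : ℝ) else 0)
          = if R ≡ c [MOD M] then 1 else 0 := fun n hn => by
      rw [(remainder_eq_iff ha hb k n R).2 (Finset.mem_Ico.1 hn)]
    rw [Finset.sum_congr rfl h, Finset.sum_const, Nat.card_Ico, nsmul_eq_mul, Nat.cast_sub hle]
    split_ifs <;> simp

theorem abs_count_modEq_sub_le {M : ℕ} (hM : 0 < M) (c R : ℕ) :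
    |(∑ r ∈ Finset.range R, if r ≡ c [MOD M] then (1 : ℝ) else 0) - (R : ℝ) / M| ≤ M := by
  have hM1 : (1 : ℝ) ≤ M := by exact_mod_cast hM
  have hi0 : 0 ≤ 1 / (M : ℝ) := by positivity
  have hi1 : 1 / (M : ℝ) ≤ 1 := (div_le_one (by positivity)).2 hM1
  have h := abs_sum_range_le_of_periodic
    (f := fun r => (if r ≡ c [MOD M] then (1 : ℝ) else 0) - 1 / M) (B := 1) hM
    (fun r => by
      split_ifs
      · rw [abs_le]; constructor <;> linarith
      · rw [abs_le]; constructor <;> linarith)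
    (fun r => by
      have : (r + M ≡ c [MOD M]) ↔ (r ≡ c [MOD M]) := by simp [Nat.ModEq]
      simp only [this])
    (by
      have := sum_range_modEq_eq M c 1 hM fun _ => 1
      rw [mul_one] at this
      rw [Finset.sum_sub_distrib, this]
      simp
      field_simp
      simp)
    R
  rw [Finset.sum_sub_distrib] at h
  rw [show (R : ℝ) / M = ∑ r ∈ Finset.range R, 1 / (M : ℝ) by simp [div_eq_mul_inv]]
  refine h.trans ?_
  rw [one_mul]
  exact min_le_right _ _

/-- The blocks `{n | remainder a b n k = r}` with `r ≡ c [MOD M]` have the expected total length,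
up to one error term for each of the `k` roundings. -/
theorem abs_residueCount_firstWith_sub_le {a b M : ℕ} (hba : b < a) (hb : 1 ≤ b) (hM : 0 < M)
    (hc : Nat.Coprime M b) (c k R : ℕ) :
    |residueCount a b M c k (firstWith a b k R) - (firstWith a b k R : ℝ) / M|
      ≤ ((a : ℝ) / b) ^ k * (M + (1 - (b : ℝ) / a)⁻¹ + ∑ j ∈ Finset.range k,
          ((b : ℝ) / a) ^ (j + 1) * min (R : ℝ) (M * b ^ (j + 1) : ℕ)) := by
  have ha : 0 < a := by omega
  have hb0 : (0 : ℝ) < b := by exact_mod_cast hb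
  set p : ℝ := (a : ℝ) / b with hp
  set q : ℝ := (b : ℝ) / a with hq
  have hp0 : 0 ≤ p ^ k := by positivity
  set cnt : ℝ := ∑ r ∈ Finset.range R, if r ≡ c [MOD M] then (1 : ℝ) else 0 with hcnt
  -- the total contribution of the `j`-th rounding, before scaling
  set Δ : ℕ → ℝ := fun j => ∑ r ∈ Finset.range R,
    if r ≡ c [MOD M] then roundup a b j (r + 1) - roundup a b j r else 0 with hΔ
  have hmain : residueCount a b M c k (firstWith a b k R)
      = p ^ k * (cnt + ∑ j ∈ Finset.range k, q ^ (j + 1) / b * Δ j) := by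
    rw [residueCount_firstWith ha hb]
    have hcomm : ∑ j ∈ Finset.range k, q ^ (j + 1) / b * Δ j = ∑ r ∈ Finset.range R,
        ∑ j ∈ Finset.range k, q ^ (j + 1) / b *
          if r ≡ c [MOD M] then roundup a b j (r + 1) - roundup a b j r else 0 := by
      simp only [hΔ]
      rw [Finset.sum_comm]
      exact Finset.sum_congr rfl fun j _ => Finset.mul_sum _ _ _
    rw [hcomm, hcnt, ← Finset.sum_add_distrib, Finset.mul_sum]
    refine Finset.sum_congr rfl fun r _ => ?_
    split_ifs
    · rw [firstWith_eq ha hb, firstWith_eq ha hb, ← mul_sub]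
      simp only [mul_sub (_ / (b : ℝ)), Finset.sum_sub_distrib]
      push_cast
      ring
    · simp
  have hΔle : ∀ j, |Δ j| ≤ b * min (R : ℝ) (M * b ^ (j + 1) : ℕ) := fun j =>
    abs_sum_jumps_modEq_le hM (by positivity) (hc.pow_right _) (roundup_periodic hb j)
      (roundup_mem_Icc hb j) c R
  have hsum : |∑ j ∈ Finset.range k, q ^ (j + 1) / b * Δ j|
      ≤ ∑ j ∈ Finset.range k, q ^ (j + 1) * min (R : ℝ) (M * b ^ (j + 1) : ℕ) := by
    refine (Finset.abs_sum_le_sum_abs _ _).trans (Finset.sum_le_sum fun j _ => ?_)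
    have hq0 : 0 ≤ q ^ (j + 1) / b := by positivity
    rw [abs_mul, abs_of_nonneg hq0]
    refine (mul_le_mul_of_nonneg_left (hΔle j) hq0).trans_eq ?_
    field_simp
  have hM1 : (1 : ℝ) ≤ M := by exact_mod_cast hM
  have hlow := le_firstWith ha hb k R
  have hupp := firstWith_le hba hb k R
  rw [← hp] at hlow hupp
  rw [← hq] at hupp
  have hfw : |p ^ k * ((R : ℝ) / M) - (firstWith a b k R : ℝ) / M| ≤ p ^ k * (1 - q)⁻¹ := by
    rw [← mul_div_assoc, ← sub_div, abs_div, abs_of_nonneg (by positivity : (0 : ℝ) ≤ M)]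
    refine (div_le_self (abs_nonneg _) hM1).trans ?_
    rw [abs_le]
    constructor <;> nlinarith
  have hcount := abs_count_modEq_sub_le hM c R
  rw [← hcnt] at hcount
  calc |residueCount a b M c k (firstWith a b k R) - (firstWith a b k R : ℝ) / M|
      = |p ^ k * (cnt - (R : ℝ) / M) + (p ^ k * ∑ j ∈ Finset.range k, q ^ (j + 1) / b * Δ j)
          + (p ^ k * ((R : ℝ) / M) - (firstWith a b k R : ℝ) / M)| := by
        rw [hmain]
        congr 1
        ring
    _ ≤ p ^ k * |cnt - (R : ℝ) / M| + p ^ k * |∑ j ∈ Finset.range k, q ^ (j + 1) / b * Δ j|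
          + p ^ k * (1 - q)⁻¹ := by
        refine (abs_add_le _ _).trans (add_le_add ((abs_add_le _ _).trans_eq ?_) hfw)
        rw [abs_mul, abs_mul, abs_of_nonneg hp0]
    _ ≤ p ^ k * M + p ^ k * (∑ j ∈ Finset.range k,
          q ^ (j + 1) * min (R : ℝ) (M * b ^ (j + 1) : ℕ)) + p ^ k * (1 - q)⁻¹ := by
        gcongr
    _ = _ := by ring

/-- The bound of `abs_residueCount_firstWith_sub_le` for an arbitrary range of summation. -/
theorem abs_residueCount_sub_le {a b M : ℕ} (hba : b < a) (hb : 1 ≤ b) (hM : 0 < M)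
    (hc : Nat.Coprime M b) (c k N : ℕ) :
    |residueCount a b M c k N - (N : ℝ) / M|
      ≤ ((a : ℝ) / b) ^ k * (M + 2 + 3 * (1 - (b : ℝ) / a)⁻¹ + ∑ j ∈ Finset.range k,
          ((b : ℝ) / a) ^ (j + 1) *
            min (remainder a b N k : ℝ) (M * b ^ (j + 1) : ℕ)) := by
  have ha : 0 < a := by omega
  set R := remainder a b N k with hR
  obtain ⟨h1, h2⟩ := (remainder_eq_iff ha hb k N R).1 rfl
  have hmain := abs_residueCount_firstWith_sub_le hba hb hM hc c k R
  have hdiff := residueCount_sub_mem_Icc a b M c k h1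
  have hM1 : (1 : ℝ) ≤ M := by exact_mod_cast hM
  -- `N` is at most one block length away from the start of its block
  have hgap : (N : ℝ) - firstWith a b k R ≤ ((a : ℝ) / b) ^ k * (1 + (1 - (b : ℝ) / a)⁻¹) := by
    have h3 : (N : ℝ) ≤ firstWith a b k (R + 1) := by exact_mod_cast h2.le
    have h4 := firstWith_le hba hb k (R + 1)
    have h5 := le_firstWith ha hb k R
    push_cast at h4
    linarith
  have hgap0 : (0 : ℝ) ≤ (N : ℝ) - firstWith a b k R := sub_nonneg.2 (by exact_mod_cast h1)
  have hgap1 : ((N : ℝ) - firstWith a b k R) / M ≤ (N : ℝ) - firstWith a b k R :=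
    div_le_self hgap0 hM1
  have hgap2 : 0 ≤ ((N : ℝ) - firstWith a b k R) / M := by positivity
  rw [sub_div] at hgap1 hgap2
  rw [abs_le] at hmain ⊢
  constructor <;> linarith [hmain.1, hmain.2, hdiff.1, hdiff.2]

/-! ### The number of occurrences of a pattern at a fixed position -/

/-- Apart from numbers too short to have a digit at each position of the pattern, an occurrence of
the pattern at position `k` means that the `k`-th remainder lies in a fixed residue class. -/
theorem abs_patternCountAt_sub_residueCount_le {a b : ℕ} (hba : b < a) (hb : 1 ≤ b) {m : ℕ}
    (w : Fin m → Fin a) {c : ℕ}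
    (hw : ∀ n, (∀ j : Fin m, digit a b n j = (w j : ℕ)) ↔ n ≡ c [MOD a ^ m]) (k N : ℕ) :
    |(patternCountAt a b w k N : ℝ) - residueCount a b (a ^ m) c k N|
      ≤ firstWith a b (k + m) 1 + 1 := by
  have ha : 0 < a := by omega
  set A : Finset ℕ := (Finset.range (N + 1)).filter fun n => 1 ≤ n ∧ k + m ≤ repLength a b n ∧
    remainder a b n k ≡ c [MOD a ^ m] with hA
  have hPA : patternCountAt a b w k N = A.card := by
    rw [patternCountAt, ← Set.ncard_coe_finset]
    congr 1
    ext n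
    simp only [hA, Set.mem_ofPred_eq, Finset.coe_filter, Finset.mem_range, digit_add, hw]
    constructor
    · rintro ⟨h1, h2, h3, h4⟩
      exact ⟨by omega, h1, h3, h4⟩
    · rintro ⟨h2, h1, h3, h4⟩
      exact ⟨h1, by omega, h3, h4⟩
  set T : Finset ℕ := (Finset.range N).filter fun n => remainder a b n k ≡ c [MOD a ^ m] with hT
  have hTc : residueCount a b (a ^ m) c k N = T.card := by
    rw [residueCount, hT, Finset.sum_boole]
  have h1 : A.card ≤ T.card + 1 := by
    refine (Finset.card_le_card (t := insert N T) fun n hn => ?_).trans (Finset.card_insert_le _ _)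
    simp only [hA, hT, Finset.mem_filter, Finset.mem_range, Finset.mem_insert] at hn ⊢
    rcases Nat.lt_succ_iff_lt_or_eq.1 hn.1 with h | h
    · exact Or.inr ⟨h, hn.2.2.2⟩
    · exact Or.inl h
  have h2 : T.card ≤ A.card + firstWith a b (k + m) 1 := by
    rw [← Finset.card_range (firstWith a b (k + m) 1)]
    refine (Finset.card_le_card (t := A ∪ Finset.range (firstWith a b (k + m) 1))
      fun n hn => ?_).trans (Finset.card_union_le _ _)
    simp only [hA, hT, Finset.mem_filter, Finset.mem_range, Finset.mem_union] at hn ⊢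
    by_cases h : n < firstWith a b (k + m) 1
    · exact Or.inr h
    · rw [not_lt, firstWith_le_iff ha hb] at h
      have h3 : k + m ≤ repLength a b n := by
        by_contra! hlt
        have := (remainder_eq_zero_iff hba n (k + m)).2 hlt.le
        omega
      have h4 : 1 ≤ n := by
        rcases Nat.eq_zero_or_pos n with rfl | h0
        · have := remainder_eq_zero_of_le (a := a) (b := b) (n := 0) rfl (Nat.zero_le (k + m))
          omega
        · exact h0
      exact Or.inl ⟨by omega, h4, h3, hn.2⟩
  have h1' : (A.card : ℝ) ≤ T.card + 1 := by exact_mod_cast h1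
  have h2' : (T.card : ℝ) ≤ A.card + firstWith a b (k + m) 1 := by exact_mod_cast h2
  have h3' : (0 : ℝ) ≤ firstWith a b (k + m) 1 := Nat.cast_nonneg _
  rw [hPA, hTc, abs_le]
  constructor <;> linarith

theorem pow_pred_repLength_le {a b N : ℕ} (hba : b < a) (hb : 1 ≤ b) (hN : 1 ≤ N) :
    ((a : ℝ) / b) ^ (repLength a b N - 1) ≤ N := by
  have hL := (isRepresentation_digit hb hba hN).length_pos
  have h1 : remainder a b N (repLength a b N - 1) ≠ 0 := fun h => by
    have := (remainder_eq_zero_iff hba N _).1 h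
    omega
  have h2 := (firstWith_le_iff (a := a) (by omega) hb (repLength a b N - 1) 1 N).2 (by omega)
  have h3 := le_firstWith (a := a) (by omega) hb (repLength a b N - 1) 1
  have h4 : (firstWith a b (repLength a b N - 1) 1 : ℝ) ≤ N := by exact_mod_cast h2
  simpa using h3.trans h4

theorem pow_repLength_le {a b N : ℕ} (hba : b < a) (hb : 1 ≤ b) (hN : 1 ≤ N) :
    ((a : ℝ) / b) ^ repLength a b N ≤ (a : ℝ) / b * N := by
  have hL := (isRepresentation_digit hb hba hN).length_pos
  have h := pow_pred_repLength_le hba hb hN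
  have h0 : 0 ≤ (a : ℝ) / b := by positivity
  calc ((a : ℝ) / b) ^ repLength a b N
      = (a : ℝ) / b * ((a : ℝ) / b) ^ (repLength a b N - 1) := by
        rw [← pow_succ']
        congr 1
        omega
    _ ≤ _ := by gcongr

theorem le_mul_pow_repLength {a b : ℕ} (hba : b < a) (hb : 1 ≤ b) (N : ℕ) :
    (N : ℝ) ≤ ((a : ℝ) / b) ^ repLength a b N * (1 + (1 - (b : ℝ) / a)⁻¹) := by
  have h1 : N < firstWith a b (repLength a b N) 1 := by
    rw [← not_le, firstWith_le_iff (by omega) hb, remainder_repLength hba]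
    omega
  have h2 := firstWith_le hba hb (repLength a b N) 1
  rw [Nat.cast_one] at h2
  exact le_trans (by exact_mod_cast h1.le) h2

theorem pow_le_mul_pow_repLength_sub {a b N k : ℕ} (hba : b < a) (hb : 1 ≤ b) (hN : 1 ≤ N)
    (hk : k ≤ repLength a b N) :
    ((a : ℝ) / b) ^ k ≤ (a : ℝ) / b * N * ((b : ℝ) / a) ^ (repLength a b N - k) := by
  have ha0 : (a : ℝ) ≠ 0 := by
    have : 0 < a := by omega
    positivity
  have hb0 : (b : ℝ) ≠ 0 := by positivity
  have h := pow_repLength_le hba hb hN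
  have h2 : ((a : ℝ) / b) ^ (repLength a b N - k) * ((b : ℝ) / a) ^ (repLength a b N - k) = 1 := by
    rw [← mul_pow, div_mul_div_cancel₀ hb0, div_self ha0, one_pow]
  calc ((a : ℝ) / b) ^ k
      = ((a : ℝ) / b) ^ k * ((a : ℝ) / b) ^ (repLength a b N - k)
          * ((b : ℝ) / a) ^ (repLength a b N - k) := by rw [mul_assoc, h2, mul_one]
    _ = ((a : ℝ) / b) ^ repLength a b N * ((b : ℝ) / a) ^ (repLength a b N - k) := by
        rw [← pow_add, Nat.add_sub_cancel' hk]
    _ ≤ _ := by gcongr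

/-- Small powers of `x` are close to `1`. -/
theorem exists_rpow_mul_lt_one {q x : ℝ} (hx : 0 < x) (hq : q < 1) :
    ∃ θ : ℝ, 0 < θ ∧ θ ≤ 1 ∧ q * x ^ θ < 1 := by
  have hcont : Tendsto (fun θ : ℝ => q * x ^ θ) (𝓝[>] 0) (𝓝 (q * x ^ (0 : ℝ))) :=
    ((Real.continuousAt_const_rpow hx.ne').tendsto.mono_left nhdsWithin_le_nhds).const_mul q
  rw [Real.rpow_zero, mul_one] at hcont
  have h1 := hcont.eventually_lt_const hq
  have h2 : ∀ᶠ θ : ℝ in 𝓝[>] 0, θ ∈ Set.Ioc (0 : ℝ) 1 := Ioc_mem_nhdsGT one_pos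
  obtain ⟨θ, hθ1, hθ2⟩ := (h1.and h2).exists
  exact ⟨θ, hθ2.1, hθ2.2, hθ1⟩

theorem min_one_le_rpow {x θ : ℝ} (hx : 0 ≤ x) (h0 : 0 ≤ θ) (h1 : θ ≤ 1) :
    min 1 x ≤ x ^ θ := by
  rcases le_total x 1 with h | h
  · calc min 1 x ≤ x ^ (1 : ℝ) := by rw [Real.rpow_one]; exact min_le_right _ _
      _ ≤ x ^ θ := Real.rpow_le_rpow_of_exponent_ge' hx h h0 h1
  · exact (min_le_left _ _).trans (Real.one_le_rpow h h0)

/-- The number of occurrences at position `k` is `N / a ^ m` up to an error that decays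
geometrically in the distance of `k` from the leading position. -/
theorem exists_abs_patternCountAt_sub_le {a b : ℕ} (hab : Nat.Coprime a b) (hba : b < a)
    (hb : 1 ≤ b) {m : ℕ} (w : Fin m → Fin a) :
    ∃ C ρ : ℝ, 0 ≤ C ∧ 0 ≤ ρ ∧ ρ < 1 ∧ ∀ N k : ℕ, 1 ≤ N → k ≤ repLength a b N →
      |(patternCountAt a b w k N : ℝ) - (N : ℝ) / (a : ℝ) ^ m|
        ≤ C * N * ρ ^ (repLength a b N - k) := by
  have ha : 0 < a := by omega
  have ha0 : (0 : ℝ) < a := by exact_mod_cast ha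
  have hb0 : (0 : ℝ) < b := by exact_mod_cast hb
  have hba' : (b : ℝ) < a := by exact_mod_cast hba
  obtain ⟨c, hc⟩ := exists_residue_of_digits ha hab m
    (fun j => if h : j < m then (w ⟨j, h⟩ : ℕ) else 0) (fun j hj => by simp [hj])
  have hw : ∀ n, (∀ j : Fin m, digit a b n j = (w j : ℕ)) ↔ n ≡ c [MOD a ^ m] := fun n => by
    rw [← hc]
    constructor
    · intro h j hj
      simpa [hj] using h ⟨j, hj⟩
    · intro h j
      simpa using h j j.2
  set p : ℝ := (a : ℝ) / b with hp
  set q : ℝ := (b : ℝ) / a with hq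
  have hp0 : 0 < p := by positivity
  have hq0 : 0 < q := by positivity
  have hq1 : q < 1 := (div_lt_one ha0).2 hba'
  have hp1 : 1 ≤ p := (one_le_div hb0).2 hba'.le
  -- the condition `q * b ^ θ < 1` makes the sum over the roundings converge
  obtain ⟨θ, hθ0, hθ1, hθ⟩ := exists_rpow_mul_lt_one hb0 hq1
  set M : ℕ := a ^ m with hMdef
  have hM : 0 < M := by positivity
  have hM1 : (1 : ℝ) ≤ M := by exact_mod_cast hM
  have hcop : Nat.Coprime M b := hab.pow_left m
  set D : ℝ := (1 - q)⁻¹ with hD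
  have hD0 : 0 ≤ D := inv_nonneg.2 (by linarith)
  set G : ℝ := (1 - q * (b : ℝ) ^ θ)⁻¹ with hG
  have hG0 : 0 ≤ G := inv_nonneg.2 (by linarith)
  set C₁ : ℝ := M + 2 + 3 * D + p ^ m * (1 + D) + 1 with hC₁
  have hC₁0 : 0 ≤ C₁ := by positivity
  refine ⟨C₁ * p + p * M * G, q ^ θ, by positivity, by positivity,
    Real.rpow_lt_one hq0.le hq1 hθ0, fun N k hN hk => ?_⟩
  have hN0 : (0 : ℝ) < N := by exact_mod_cast hN
  set K := repLength a b N - k with hK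
  have hpk : p ^ k ≤ p * N * q ^ K := pow_le_mul_pow_repLength_sub hba hb hN hk
  have hqK : q ^ K ≤ (q ^ θ) ^ K := by
    gcongr
    calc q = q ^ (1 : ℝ) := (Real.rpow_one q).symm
      _ ≤ q ^ θ := Real.rpow_le_rpow_of_exponent_ge hq0 hq1.le hθ1
  have hmain := abs_residueCount_sub_le hba hb hM hcop c k N
  have hpat := abs_patternCountAt_sub_residueCount_le hba hb w hw k N
  have hfw : (firstWith a b (k + m) 1 : ℝ) ≤ p ^ k * (p ^ m * (1 + D)) := by
    have := firstWith_le hba hb (k + m) 1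
    rwa [Nat.cast_one, pow_add, mul_assoc] at this
  have hone : 1 ≤ p ^ k := one_le_pow₀ hp1
  have hterm : ∀ j ∈ Finset.range k,
      p ^ k * (q ^ (j + 1) * min (remainder a b N k : ℝ) (M * b ^ (j + 1) : ℕ))
        ≤ p * M * N * (q ^ θ) ^ K * (q * (b : ℝ) ^ θ) ^ j := by
    intro j _
    have hR : p ^ k * remainder a b N k ≤ N := by
      refine (le_firstWith ha hb k _).trans ?_
      exact_mod_cast (firstWith_le_iff ha hb k _ N).2 le_rfl
    -- with `X = p * M * b ^ (j + 1) * q ^ K`, replacing `min 1 X` by `X ^ θ` separates `j` from `K`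
    have hX0 : 0 ≤ p * M * (b : ℝ) ^ (j + 1) * q ^ K := by positivity
    have hmin : p ^ k * min (remainder a b N k : ℝ) (M * b ^ (j + 1) : ℕ)
        ≤ N * min 1 (p * M * (b : ℝ) ^ (j + 1) * q ^ K) := by
      rw [mul_min_of_nonneg _ _ hN0.le, mul_min_of_nonneg _ _ (by positivity : 0 ≤ p ^ k), mul_one]
      refine min_le_min hR ?_
      push_cast
      calc p ^ k * ((M : ℝ) * (b : ℝ) ^ (j + 1))
          ≤ p * N * q ^ K * ((M : ℝ) * (b : ℝ) ^ (j + 1)) := by gcongr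
        _ = _ := by ring
    have hrpow : (p * M * (b : ℝ) ^ (j + 1) * q ^ K) ^ θ
        ≤ p * M * ((b : ℝ) ^ θ) ^ (j + 1) * (q ^ θ) ^ K := by
      rw [Real.mul_rpow (by positivity) (by positivity),
        Real.mul_rpow (by positivity) (by positivity),
        ← Real.rpow_pow_comm hb0.le, ← Real.rpow_pow_comm hq0.le]
      gcongr
      calc (p * M) ^ θ ≤ (p * M) ^ (1 : ℝ) :=
            Real.rpow_le_rpow_of_exponent_le (one_le_mul_of_one_le_of_one_le hp1 hM1) hθ1
        _ = p * M := Real.rpow_one _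
    calc p ^ k * (q ^ (j + 1) * min (remainder a b N k : ℝ) (M * b ^ (j + 1) : ℕ))
        = q ^ (j + 1) * (p ^ k * min (remainder a b N k : ℝ) (M * b ^ (j + 1) : ℕ)) := by ring
      _ ≤ q ^ (j + 1) * (N * (p * M * ((b : ℝ) ^ θ) ^ (j + 1) * (q ^ θ) ^ K)) := by
          refine mul_le_mul_of_nonneg_left ?_ (by positivity)
          exact hmin.trans (mul_le_mul_of_nonneg_left
            ((min_one_le_rpow hX0 hθ0.le hθ1).trans hrpow) hN0.le)
      _ = p * M * N * (q ^ θ) ^ K * (q * (b : ℝ) ^ θ) ^ (j + 1) := by ring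
      _ ≤ p * M * N * (q ^ θ) ^ K * (q * (b : ℝ) ^ θ) ^ j := by
          exact mul_le_mul_of_nonneg_left
            (pow_le_pow_of_le_one (by positivity) hθ.le (by omega)) (by positivity)
  have hsum : p ^ k * ∑ j ∈ Finset.range k,
        q ^ (j + 1) * min (remainder a b N k : ℝ) (M * b ^ (j + 1) : ℕ)
      ≤ p * M * N * (q ^ θ) ^ K * G := by
    rw [Finset.mul_sum]
    refine (Finset.sum_le_sum hterm).trans ?_
    rw [← Finset.mul_sum]
    gcongr
    exact geomSum_le_inv (by positivity) hθ k
  have hMcast : (M : ℝ) = (a : ℝ) ^ m := by rw [hMdef]; push_cast; rfl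
  rw [← hMcast]
  calc |(patternCountAt a b w k N : ℝ) - (N : ℝ) / M|
      ≤ |(patternCountAt a b w k N : ℝ) - residueCount a b M c k N|
          + |residueCount a b M c k N - (N : ℝ) / M| := abs_sub_le _ _ _
    _ ≤ (p ^ k * (p ^ m * (1 + D)) + p ^ k) + (p ^ k * (M + 2 + 3 * D)
          + p * M * N * (q ^ θ) ^ K * G) := by
        refine add_le_add (hpat.trans (add_le_add hfw hone)) (hmain.trans ?_)
        rw [mul_add]
        gcongr
    _ = C₁ * p ^ k + p * M * N * (q ^ θ) ^ K * G := by rw [hC₁]; ring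
    _ ≤ C₁ * (p * N * (q ^ θ) ^ K) + p * M * N * (q ^ θ) ^ K * G := by
        gcongr
        exact hpk.trans (by gcongr)
    _ = (C₁ * p + p * M * G) * N * (q ^ θ) ^ K := by ring

/-! ### Summation over all positions -/

theorem repLength_le_iff {a b : ℕ} (hba : b < a) (hb : 1 ≤ b) (n k : ℕ) :
    repLength a b n ≤ k ↔ n < firstWith a b k 1 := by
  rw [← remainder_eq_zero_iff hba, ← not_le, firstWith_le_iff (by omega) hb]
  omega

theorem repLength_mono {a b : ℕ} (hba : b < a) (hb : 1 ≤ b) : Monotone (repLength a b) :=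
  fun _ _ h => (repLength_le_iff hba hb _ _).2
    (h.trans_lt ((repLength_le_iff hba hb _ _).1 le_rfl))

theorem sum_pow_sub_le {ρ : ℝ} (h0 : 0 ≤ ρ) (h1 : ρ < 1) {K L : ℕ} (hK : K ≤ L + 1) :
    ∑ k ∈ Finset.range K, ρ ^ (L - k) ≤ (1 - ρ)⁻¹ := by
  calc ∑ k ∈ Finset.range K, ρ ^ (L - k)
      ≤ ∑ k ∈ Finset.range (L + 1), ρ ^ (L - k) :=
        Finset.sum_le_sum_of_subset_of_nonneg (Finset.range_mono hK) fun _ _ _ => by positivity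
    _ = ∑ k ∈ Finset.range (L + 1), ρ ^ k := by
        simpa using Finset.sum_range_reflect (fun k => ρ ^ k) (L + 1)
    _ ≤ (1 - ρ)⁻¹ := geomSum_le_inv h0 h1 _

/-- The length of the representation is `Real.logb (a / b) N` up to a bounded error. -/
theorem exists_abs_repLength_sub_logb_le {a b : ℕ} (hba : b < a) (hb : 1 ≤ b) :
    ∃ C : ℝ, ∀ N : ℕ, 1 ≤ N →
      |(repLength a b N : ℝ) - Real.logb ((a : ℝ) / b) N| ≤ C := by
  have hb0 : (0 : ℝ) < b := by exact_mod_cast hb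
  have ha0 : (0 : ℝ) < a := by exact_mod_cast (by omega : 0 < a)
  have hba' : (b : ℝ) < a := by exact_mod_cast hba
  have hp1 : 1 < (a : ℝ) / b := (one_lt_div hb0).2 hba'
  have hp0 : 0 < (a : ℝ) / b := by positivity
  have hq1 : (b : ℝ) / a < 1 := (div_lt_one ha0).2 hba'
  have hD0 : 0 < 1 + (1 - (b : ℝ) / a)⁻¹ := by
    have : 0 < 1 - (b : ℝ) / a := by linarith
    positivity
  refine ⟨max 1 (Real.logb ((a : ℝ) / b) (1 + (1 - (b : ℝ) / a)⁻¹)), fun N hN => ?_⟩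
  have hN0 : (0 : ℝ) < N := by exact_mod_cast hN
  have hL := (isRepresentation_digit hb hba hN).length_pos
  have h1 := Real.logb_le_logb_of_le hp1 (by positivity) (pow_pred_repLength_le hba hb hN)
  have h2 := Real.logb_le_logb_of_le hp1 hN0 (le_mul_pow_repLength hba hb N)
  rw [Real.logb_pow, Real.logb_self_eq_one hp1, mul_one, Nat.cast_sub hL, Nat.cast_one] at h1
  rw [Real.logb_mul (by positivity) hD0.ne', Real.logb_pow, Real.logb_self_eq_one hp1,
    mul_one] at h2
  rw [abs_le]
  constructor
  · linarith [le_max_right 1 (Real.logb ((a : ℝ) / b) (1 + (1 - (b : ℝ) / a)⁻¹))]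
  · linarith [le_max_left 1 (Real.logb ((a : ℝ) / b) (1 + (1 - (b : ℝ) / a)⁻¹))]

/-- Summing the geometrically decaying errors over all positions leaves an error `O(N)`. -/
theorem exists_abs_patternCount_sub_le {a b : ℕ} (hab : Nat.Coprime a b) (hba : b < a)
    (hb : 1 ≤ b) {m : ℕ} (w : Fin m → Fin a) :
    ∃ C : ℝ, ∀ N : ℕ, 1 ≤ N →
      |(patternCount a b w N : ℝ) - (N : ℝ) / (a : ℝ) ^ m * Real.logb ((a : ℝ) / b) N|
        ≤ C * N := by
  obtain ⟨C, ρ, hC, hρ0, hρ1, h⟩ := exists_abs_patternCountAt_sub_le hab hba hb w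
  obtain ⟨C', hC'⟩ := exists_abs_repLength_sub_logb_le hba hb
  refine ⟨C * (1 - ρ)⁻¹ + (m + 1 + C'), fun N hN => ?_⟩
  set L := repLength a b N with hL
  set M : ℝ := (a : ℝ) ^ m with hM
  have ha1 : (1 : ℝ) ≤ a := by exact_mod_cast (by omega : 1 ≤ a)
  have hM1 : 1 ≤ M := one_le_pow₀ ha1
  have h1 : |(patternCount a b w N : ℝ) - N / M * (L + 1 - m : ℕ)| ≤ C * (1 - ρ)⁻¹ * N := by
    have : (N : ℝ) / M * (L + 1 - m : ℕ) = ∑ k ∈ Finset.range (L + 1 - m), (N : ℝ) / M := by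
      simp [mul_comm]
    rw [this, patternCount, Nat.cast_sum, ← Finset.sum_sub_distrib]
    calc |∑ k ∈ Finset.range (L + 1 - m), ((patternCountAt a b w k N : ℝ) - N / M)|
        ≤ ∑ k ∈ Finset.range (L + 1 - m), C * N * ρ ^ (L - k) := by
          refine (Finset.abs_sum_le_sum_abs _ _).trans (Finset.sum_le_sum fun k hk => ?_)
          have := Finset.mem_range.1 hk
          exact h N k hN (by omega)
      _ ≤ C * N * (1 - ρ)⁻¹ := by
          rw [← Finset.mul_sum]
          gcongr
          exact sum_pow_sub_le hρ0 hρ1 (by omega)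
      _ = _ := by ring
  have h2 : |((L + 1 - m : ℕ) : ℝ) - Real.logb ((a : ℝ) / b) N| ≤ m + 1 + C' := by
    have h3 : ((L + 1 - m : ℕ) : ℝ) ≤ L + 1 := by
      exact_mod_cast (by omega : L + 1 - m ≤ L + 1)
    have h4 : (L : ℝ) + 1 ≤ (L + 1 - m : ℕ) + m := by
      exact_mod_cast (by omega : L + 1 ≤ L + 1 - m + m)
    have h5 := abs_le.1 (hC' N hN)
    have h6 : (0 : ℝ) ≤ m := Nat.cast_nonneg m
    rw [abs_le]
    constructor <;> linarith [h5.1, h5.2]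
  have h3 : |(N : ℝ) / M * (L + 1 - m : ℕ) - N / M * Real.logb ((a : ℝ) / b) N|
      ≤ (m + 1 + C') * N := by
    rw [← mul_sub, abs_mul, abs_of_nonneg (by positivity : 0 ≤ (N : ℝ) / M), mul_comm]
    have : (N : ℝ) / M ≤ N := div_le_self (Nat.cast_nonneg N) hM1
    exact mul_le_mul h2 this (by positivity) ((abs_nonneg _).trans h2)
  calc _ ≤ _ := abs_sub_le _ ((N : ℝ) / M * (L + 1 - m : ℕ)) _
    _ ≤ C * (1 - ρ)⁻¹ * N + (m + 1 + C') * N := add_le_add h1 h3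
    _ = _ := by ring

/-- The total length of the representations of `1, …, N` is asymptotically the one that would
result if all of them were as long as that of `N`. -/
theorem exists_abs_sum_repLength_sub_le {a b : ℕ} (hba : b < a) (hb : 1 ≤ b) :
    ∃ C : ℝ, ∀ N : ℕ, 1 ≤ N →
      |∑ n ∈ Finset.Icc 1 N, (repLength a b n : ℝ) - (N : ℝ) * Real.logb ((a : ℝ) / b) N|
        ≤ C * N := by
  obtain ⟨C', hC'⟩ := exists_abs_repLength_sub_logb_le hba hb
  have hb0 : (0 : ℝ) < b := by exact_mod_cast hb
  have ha0 : (0 : ℝ) < a := by exact_mod_cast (by omega : 0 < a)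
  have hq0 : 0 ≤ (b : ℝ) / a := by positivity
  have hq1 : (b : ℝ) / a < 1 := (div_lt_one ha0).2 (by exact_mod_cast hba)
  set D : ℝ := (1 - (b : ℝ) / a)⁻¹ with hD
  have hD0 : 0 ≤ D := inv_nonneg.2 (by linarith)
  refine ⟨(a : ℝ) / b * (1 + D) * D + C', fun N hN => ?_⟩
  set L := repLength a b N with hL
  have hupp : ∑ n ∈ Finset.Icc 1 N, (repLength a b n : ℝ) ≤ N * L := by
    refine (Finset.sum_le_card_nsmul _ _ (L : ℝ) fun n hn => ?_).trans_eq (by simp)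
    exact_mod_cast repLength_mono hba hb (Finset.mem_Icc.1 hn).2
  -- each `n` misses the positions `k` with `repLength a b n ≤ k`, and few `n` miss a given `k`
  have hlow : (N : ℝ) * L ≤
      ∑ n ∈ Finset.Icc 1 N, (repLength a b n : ℝ) + (a : ℝ) / b * (1 + D) * D * N := by
    have h1 : ∀ n, (L : ℝ) ≤ repLength a b n +
        ∑ k ∈ Finset.range L, if repLength a b n ≤ k then (1 : ℝ) else 0 := fun n => by
      rw [Finset.sum_boole]
      have : Finset.Ico (repLength a b n) L ⊆
          (Finset.range L).filter (fun k => repLength a b n ≤ k) := fun k hk => by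
        simp only [Finset.mem_Ico, Finset.mem_filter, Finset.mem_range] at hk ⊢
        exact hk.symm
      have h2 := Finset.card_le_card this
      rw [Nat.card_Ico] at h2
      exact_mod_cast (by omega)
    have h2 : ∀ k ∈ Finset.range L,
        (∑ n ∈ Finset.Icc 1 N, if repLength a b n ≤ k then (1 : ℝ) else 0)
          ≤ (a : ℝ) / b * N * (1 + D) * ((b : ℝ) / a) ^ (L - k) := fun k hk => by
      have h3 : (Finset.Icc 1 N).filter (fun n => repLength a b n ≤ k) ⊆
          Finset.range (firstWith a b k 1) := fun n hn => by
        rw [Finset.mem_range, ← repLength_le_iff hba hb]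
        exact (Finset.mem_filter.1 hn).2
      have h4 := Finset.card_le_card h3
      rw [Finset.card_range] at h4
      rw [Finset.sum_boole]
      have h5 := firstWith_le hba hb k 1
      rw [Nat.cast_one] at h5
      calc _ ≤ (firstWith a b k 1 : ℝ) := by exact_mod_cast h4
        _ ≤ ((a : ℝ) / b) ^ k * (1 + D) := h5
        _ ≤ (a : ℝ) / b * N * ((b : ℝ) / a) ^ (L - k) * (1 + D) := by
            gcongr
            exact pow_le_mul_pow_repLength_sub hba hb hN (Finset.mem_range.1 hk).le
        _ = _ := by ring
    calc (N : ℝ) * L = ∑ n ∈ Finset.Icc 1 N, (L : ℝ) := by simp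
      _ ≤ ∑ n ∈ Finset.Icc 1 N, ((repLength a b n : ℝ) +
            ∑ k ∈ Finset.range L, if repLength a b n ≤ k then (1 : ℝ) else 0) :=
          Finset.sum_le_sum fun n _ => h1 n
      _ = ∑ n ∈ Finset.Icc 1 N, (repLength a b n : ℝ) + ∑ k ∈ Finset.range L,
            ∑ n ∈ Finset.Icc 1 N, if repLength a b n ≤ k then (1 : ℝ) else 0 := by
          rw [Finset.sum_add_distrib, Finset.sum_comm (s := Finset.range L)]
      _ ≤ ∑ n ∈ Finset.Icc 1 N, (repLength a b n : ℝ) +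
            (a : ℝ) / b * N * (1 + D) * D := by
          gcongr
          refine (Finset.sum_le_sum h2).trans ?_
          rw [← Finset.mul_sum]
          gcongr
          exact sum_pow_sub_le hq0 hq1 (by omega)
      _ = _ := by ring
  have h3 : |(N : ℝ) * L - N * Real.logb ((a : ℝ) / b) N| ≤ C' * N := by
    rw [← mul_sub, abs_mul, Nat.abs_cast, mul_comm]
    gcongr
    exact hC' N hN
  rw [abs_le] at h3 ⊢
  constructor <;> nlinarith [h3.1, h3.2, (by positivity : 0 ≤ (a : ℝ) / b * (1 + D) * D * N)]

/-- An asymptotic expansion `f N = c * N * l N + O(N)` with `l → ∞` determines the limit of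
`f N / (N * l N)`. -/
theorem tendsto_div_of_abs_sub_le {f l : ℕ → ℝ} {c C : ℝ} (hl : Tendsto l atTop atTop)
    (h : ∀ N : ℕ, 1 ≤ N → |f N - c * (N * l N)| ≤ C * N) :
    Tendsto (fun N : ℕ => f N / (N * l N)) atTop (𝓝 c) := by
  rw [tendsto_iff_norm_sub_tendsto_zero]
  refine squeeze_zero' (Eventually.of_forall fun _ => norm_nonneg _) ?_ (hl.const_div_atTop C)
  filter_upwards [eventually_ge_atTop 1, hl.eventually_gt_atTop 0] with N hN hlN
  have hN0 : (0 : ℝ) < N := by exact_mod_cast hN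
  have hpos : 0 < N * l N := mul_pos hN0 hlN
  rw [Real.norm_eq_abs, div_sub' hpos.ne', abs_div, abs_of_pos hpos, div_le_div_iff₀ hpos hlN]
  calc _ ≤ C * N * l N := by
        gcongr
        rw [mul_comm _ c]
        exact h N hN
    _ = _ := by ring

end RationalBase

theorem mainTheorem1 (a b : ℕ) (hab : Nat.Coprime a b) (hba : b < a) (hb : 1 ≤ b)
    (m : ℕ) (w : Fin m → Fin a) :
    ((fun N : ℕ => (RationalBase.patternCount a b w N : ℝ)
        - (N : ℝ) / (a : ℝ) ^ m * Real.logb ((a : ℝ) / (b : ℝ)) (N : ℝ))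
      =O[atTop] fun N : ℕ => (N : ℝ) * Real.log (Real.log (N : ℝ))) ∧
    Tendsto (fun N : ℕ => (RationalBase.patternCount a b w N : ℝ)
        / ∑ n ∈ Finset.Icc 1 N, (RationalBase.repLength a b n : ℝ))
      atTop (𝓝 (1 / (a : ℝ) ^ m)) := by
  obtain ⟨C₁, h₁⟩ := RationalBase.exists_abs_patternCount_sub_le hab hba hb w
  obtain ⟨C₂, h₂⟩ := RationalBase.exists_abs_sum_repLength_sub_le hba hb
  have hp1 : 1 < (a : ℝ) / b :=
    (one_lt_div (by exact_mod_cast hb)).2 (by exact_mod_cast hba)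
  constructor
  · -- the error is in fact `O(N)`
    have hloglog : Tendsto (fun N : ℕ => Real.log (Real.log (N : ℝ))) atTop atTop :=
      Real.tendsto_log_atTop.comp (Real.tendsto_log_atTop.comp tendsto_natCast_atTop_atTop)
    refine IsBigO.of_bound C₁ ?_
    filter_upwards [eventually_ge_atTop 1, hloglog.eventually_ge_atTop 1] with N hN hlog
    have hC : 0 ≤ C₁ * N := (abs_nonneg _).trans (h₁ N hN)
    rw [Real.norm_eq_abs, Real.norm_eq_abs, abs_mul, Nat.abs_cast,
      abs_of_nonneg (zero_le_one.trans hlog), ← mul_assoc]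
    exact (h₁ N hN).trans (le_mul_of_one_le_right hC hlog)
  · have hl : Tendsto (fun N : ℕ => Real.logb ((a : ℝ) / b) N) atTop atTop :=
      (Real.tendsto_logb_atTop hp1).comp tendsto_natCast_atTop_atTop
    have ht₁ := RationalBase.tendsto_div_of_abs_sub_le
      (f := fun N => (RationalBase.patternCount a b w N : ℝ)) (c := 1 / (a : ℝ) ^ m)
      (C := C₁) hl
      (fun N hN => by
        rw [← mul_assoc, one_div_mul_eq_div]
        exact h₁ N hN)
    have ht₂ := RationalBase.tendsto_div_of_abs_sub_le (c := 1) (C := C₂) hl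
      (fun N hN => by
        rw [one_mul]
        exact h₂ N hN)
    have ht := ht₁.div ht₂ one_ne_zero
    rw [div_one] at ht
    refine ht.congr' ?_
    filter_upwards [eventually_ge_atTop 1, hl.eventually_gt_atTop 0] with N hN hlN
    have hN0 : (0 : ℝ) < N := by exact_mod_cast hN
    exact div_div_div_cancel_right₀ (mul_pos hN0 hlN).ne' _ _
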